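/- Let $q$ be a prime power with $q\equiv\pm1\pmod 8$, let $G=\mathrm{PSL}(2,q)=\mathrm{SL}(2,\mathbb F_q)/Z(\mathrm{SL}(2,\mathbb F_q))$, let $H$ be a subgroup of $G$, and let $Q$ be a Sylow $2$-subgroup of $H$. For a subset $S\subseteq G$ with $1\notin S$ and $S^{-1}=S$, let $\mathrm{Cay}(G,S)$ be the graph with vertex set $G$ in which $x$ and $y$ are adjacent if and only if $yx^{-1}\in S$. A subset $C\subseteq G$ is called a perfect code of $G$ if there is such an $S$ for which no two vertices of $C$ are adjacent in $\mathrm{Cay}(G,S)$ and every vertex in $G\setminus C$ is adjacent to exactly one vertex of $C$. Then $H$ is a perfect code of $G$ if and only if one of the following holds: 1. $Q$ is trivial; 2. $Q$ is noncyclic; 3. $Q$ is cyclic and $|Q|$ is the maximum of the orders of the cyclic $2$-subgroups of $G$. -/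

import Mathlib

open scoped MatrixGroups Pointwise

namespace SubgroupCode

/-- A set `C` of vertices is a perfect code in `Γ` if it is independent and every vertex
outside `C` is adjacent to exactly one vertex of `C`. -/
def IsPerfectCodeIn {V : Type*} (Γ : SimpleGraph V) (C : Set V) : Prop :=
  (∀ x ∈ C, ∀ y ∈ C, ¬ Γ.Adj x y) ∧ ∀ v, v ∉ C → ∃! c, c ∈ C ∧ Γ.Adj v c

/-- The Cayley graph `Cay(G, S)` of a connection set `S` with `1 ∉ S` and `S⁻¹ = S`:
`x` and `y` are adjacent if and only if `y * x⁻¹ ∈ S`. -/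
def cayleyGraph {G : Type*} [Group G] (S : Set G) (h_one : (1 : G) ∉ S) (h_inv : S⁻¹ = S) :
    SimpleGraph G where
  Adj x y := y * x⁻¹ ∈ S
  symm := ⟨fun x y h => by
    rw [← h_inv, Set.mem_inv]
    simpa using h⟩
  loopless := ⟨fun x h => h_one (by simpa using h)⟩

/-- A subset of a group is a perfect code of the group if it is a perfect code in some
Cayley graph of the group. -/
def IsPerfectCode {G : Type*} [Group G] (C : Set G) : Prop :=
  ∃ (S : Set G) (h_one : (1 : G) ∉ S) (h_inv : S⁻¹ = S),
    IsPerfectCodeIn (cayleyGraph S h_one h_inv) C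

/-- `n` is the largest order of a cyclic `2`-subgroup of `G`. -/
def IsMaxCyclicTwoOrder (G : Type*) [Group G] (n : ℕ) : Prop :=
  IsGreatest {m : ℕ | ∃ C : Subgroup G, IsCyclic C ∧ IsPGroup 2 C ∧ Nat.card C = m} n

end SubgroupCode

/-! A subgroup `H` is a perfect code exactly when the nontrivial left cosets of `H` have an
inverse-closed set of representatives. Cosets in mutually inverse double cosets can be represented
by pairs `u`, `u⁻¹`, so the only obstruction is a self-inverse nontrivial double coset with an odd
number of left cosets and no involution (`isPerfectCode_of_doubleCoset`,
`IsPerfectCode.exists_mul_self_eq_one`). Sylow arguments reduce sufficiency to the normalizer of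
`Q`: it is enough that every 2-element `x` normalizing `Q` with `x² ∈ Q` has an element of square 1
in `xQ` (`isPerfectCode_of_normalizer`).

Two facts about PSL(2, q) finish the proof. For q odd, the centralizer of an involution is dihedral
in nature: outside a cyclic subgroup `T` all its elements square to 1 (`exists_isCyclicTorus`). For
q ≡ ±1 mod 8, 2 is a square in the field, hence every involution of PSL(2, q) is a square
(`exists_mul_self_eq_of_involution`). If the coset condition fails, `Q⟨x⟩` lies in such a `T`, so
`Q` is cyclic and properly contained in a cyclic 2-group. Conversely, a nontrivial cyclic `Q` of
non-maximal order is generated by a square `x²`, and then `HxH` is an obstruction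
(`not_isPerfectCode_of_mul_self`). -/

namespace SubgroupCode

open DoubleCoset

/-! ### Double cosets as unions of left cosets, and inversion. -/

section Cosets

variable {G : Type*} [Group G]

/-- The double coset `H g H` containing a given left coset `g H`. -/
def cosetDoubleCoset (H : Subgroup G) (C : G ⧸ H) : Set G :=
  Quotient.liftOn' C (fun g => doubleCoset g (H : Set G) H) (by
    intro a b hab
    rw [QuotientGroup.leftRel_apply] at hab
    refine (doubleCoset_eq_of_mem (mem_doubleCoset.2 ⟨1, H.one_mem, a⁻¹ * b, hab, ?_⟩)).symm
    group)

lemma cosetDoubleCoset_mk (H : Subgroup G) (g : G) :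
    cosetDoubleCoset H (g : G ⧸ H) = doubleCoset g (H : Set G) H := rfl

lemma inv_mem_doubleCoset_inv {H : Subgroup G} {a b : G} (h : b ∈ doubleCoset a (H : Set G) H) :
    b⁻¹ ∈ doubleCoset a⁻¹ (H : Set G) H := by
  obtain ⟨x, hx, y, hy, rfl⟩ := mem_doubleCoset.1 h
  exact mem_doubleCoset.2 ⟨y⁻¹, H.inv_mem hy, x⁻¹, H.inv_mem hx, by group⟩

lemma doubleCoset_inv (H : Subgroup G) (g : G) :
    doubleCoset g⁻¹ (H : Set G) H = (doubleCoset g (H : Set G) H)⁻¹ := by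
  ext b
  rw [Set.mem_inv]
  exact ⟨fun h => by simpa using inv_mem_doubleCoset_inv h,
    fun h => by simpa using inv_mem_doubleCoset_inv h⟩

/-- Writing `b⁻¹ = x a y` with `x, y ∈ H`, the element `u = a y` lies in `aH` and `u⁻¹ = b x` in
`bH`. -/
lemma exists_mk_eq_mk_inv_eq {H : Subgroup G} {C C' : G ⧸ H}
    (h : cosetDoubleCoset H C' = (cosetDoubleCoset H C)⁻¹) :
    ∃ u : G, (u : G ⧸ H) = C ∧ ((u⁻¹ : G) : G ⧸ H) = C' := by
  induction C using QuotientGroup.induction_on with | H a =>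
  induction C' using QuotientGroup.induction_on with | H b =>
  rw [cosetDoubleCoset_mk, cosetDoubleCoset_mk] at h
  have hb : b⁻¹ ∈ doubleCoset a (H : Set G) H := by
    have := mem_doubleCoset_self H H b
    rwa [h] at this
  obtain ⟨x, hx, y, hy, hxy⟩ := mem_doubleCoset.1 hb
  have hb' : b = y⁻¹ * a⁻¹ * x⁻¹ := by rw [← inv_inv b, hxy]; group
  refine ⟨a * y, ?_, ?_⟩
  · rw [QuotientGroup.eq]
    simpa using hy
  · rw [QuotientGroup.eq, hb']
    simpa [mul_assoc] using hx

lemma cosetDoubleCoset_eq_of_mem {H : Subgroup G} {C : G ⧸ H} {b : G}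
    (hb : b ∈ cosetDoubleCoset H C) : cosetDoubleCoset H (b : G ⧸ H) = cosetDoubleCoset H C := by
  induction C using QuotientGroup.induction_on with | H a =>
  exact doubleCoset_eq_of_mem hb

lemma ncard_cosets_mul_card (H : Subgroup G) (E : Set G) :
    Nat.card {g : G // cosetDoubleCoset H (g : G ⧸ H) = E} =
      Nat.card H * Nat.card {C : G ⧸ H // cosetDoubleCoset H C = E} := by
  have := QuotientGroup.card_preimage_mk H {C : G ⧸ H | cosetDoubleCoset H C = E}
  exact this

/-- Inversion does not preserve left cosets, so elements are counted instead and the factor `|H|` is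
cancelled. -/
lemma card_cosets_inv [Finite G] (H : Subgroup G) (E : Set G) :
    Nat.card {C : G ⧸ H // cosetDoubleCoset H C = E} =
      Nat.card {C : G ⧸ H // cosetDoubleCoset H C = E⁻¹} := by
  refine Nat.eq_of_mul_eq_mul_left (Nat.card_pos (α := H)) ?_
  rw [← ncard_cosets_mul_card, ← ncard_cosets_mul_card]
  refine Nat.card_congr ((Equiv.inv G).subtypeEquiv fun g => ?_)
  rw [Equiv.inv_apply, cosetDoubleCoset_mk, cosetDoubleCoset_mk, doubleCoset_inv, inv_inj]

end Cosets

/-! ### Inverse-closed representatives by pairing cosets. -/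

lemma card_filter_erase_add {α : Type*} [DecidableEq α] (p : α → Prop) [DecidablePred p]
    {Z : Finset α} {a : α} (ha : a ∈ Z) :
    ((Z.erase a).filter p).card + (if p a then 1 else 0) = (Z.filter p).card := by
  rw [Finset.card_filter, Finset.card_filter]
  exact Finset.sum_erase_add Z (fun i => if p i then 1 else 0) ha

open Classical in
/-- A family of left cosets containing as many cosets from each double coset `D` as from `D⁻¹`, and
containing a coset of an involution from each self-inverse `D` which contributes an odd number,
has an inverse-closed set of representatives. -/
lemma exists_inv_closed_representatives {G : Type*} [Group G] (H : Subgroup G) (n : ℕ) :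
    ∀ Z : Finset (G ⧸ H), Z.card = n →
      (∀ E : Set G, (Z.filter fun C => cosetDoubleCoset H C = E).card =
        (Z.filter fun C => cosetDoubleCoset H C = E⁻¹).card) →
      (∀ E : Set G, E⁻¹ = E → Odd (Z.filter fun C => cosetDoubleCoset H C = E).card →
        ∃ b ∈ E, b * b = 1 ∧ (b : G ⧸ H) ∈ Z) →
      ∃ S : Set G, S⁻¹ = S ∧ Set.BijOn (fun g : G => (g : G ⧸ H)) S Z := by
  induction n using Nat.strong_induction_on with | _ n ih =>
  intro Z hZn hbal hodd
  rcases Z.eq_empty_or_nonempty with rfl | ⟨C₀, hC₀⟩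
  · exact ⟨∅, by simp, by simp⟩
  have mem_of_odd : ∀ (W : Finset (G ⧸ H)) (E : Set G),
      Odd (W.filter fun C => cosetDoubleCoset H C = E).card →
      ∃ C, cosetDoubleCoset H C = E := by
    intro W E h
    obtain ⟨C, hC⟩ := Finset.card_pos.1 h.pos
    exact ⟨C, (Finset.mem_filter.1 hC).2⟩
  -- Induction step that spends two cosets on a pair `u`, `u⁻¹`. The evenness condition covers a
  -- pair taken from one double coset: its count stays even, so no involution is demanded there
  -- afterwards.
  have remove_pair : ∀ C ∈ Z, ∀ C' ∈ Z, C' ≠ C →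
      cosetDoubleCoset H C' = (cosetDoubleCoset H C)⁻¹ →
      (cosetDoubleCoset H C' = cosetDoubleCoset H C →
        Even (Z.filter fun D => cosetDoubleCoset H D = cosetDoubleCoset H C).card) →
      ∃ S : Set G, S⁻¹ = S ∧ Set.BijOn (fun g : G => (g : G ⧸ H)) S Z := by
    intro C hC C' hC' hne hinv hev
    have hC'' : C' ∈ Z.erase C := Finset.mem_erase.2 ⟨hne, hC'⟩
    have hcount : ∀ E : Set G,
        (((Z.erase C).erase C').filter fun D => cosetDoubleCoset H D = E).card +
          (if cosetDoubleCoset H C' = E then 1 else 0) +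
          (if cosetDoubleCoset H C = E then 1 else 0) =
        (Z.filter fun D => cosetDoubleCoset H D = E).card := by
      intro E
      rw [card_filter_erase_add _ hC'', card_filter_erase_add _ hC]
    obtain ⟨S, hS, hbij⟩ := ih _ (by
        rw [Finset.card_erase_of_mem hC'', Finset.card_erase_of_mem hC, hZn]
        have : 0 < Z.card := Finset.card_pos.2 ⟨_, hC⟩
        omega) ((Z.erase C).erase C') rfl (by
        intro E
        have h1 := hcount E
        have h2 := hcount E⁻¹
        have h3 := hbal E
        have e1 : cosetDoubleCoset H C' = E⁻¹ ↔ cosetDoubleCoset H C = E := by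
          rw [hinv, inv_inj]
        have e2 : cosetDoubleCoset H C = E⁻¹ ↔ cosetDoubleCoset H C' = E := by
          rw [hinv, inv_eq_iff_eq_inv]
        simp only [e1, e2] at h2
        omega) (by
        intro E hE ho
        have h1 := hcount E
        have e1 : cosetDoubleCoset H C' = E ↔ cosetDoubleCoset H C = E := by
          rw [hinv, inv_eq_iff_eq_inv, hE]
        by_cases hCE : cosetDoubleCoset H C = E
        · have := hev ((e1.2 hCE).trans hCE.symm)
          rw [hCE] at this
          simp only [e1, if_pos hCE] at h1
          rw [← h1] at this
          exfalso
          grind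
        · simp only [e1, if_neg hCE, add_zero] at h1
          obtain ⟨b, hb, hb1, hbZ⟩ := hodd E hE (h1 ▸ ho)
          obtain ⟨D, hD⟩ := mem_of_odd _ _ ho
          have hbE : cosetDoubleCoset H (b : G ⧸ H) = E := by
            rw [← hD] at hb ⊢
            exact cosetDoubleCoset_eq_of_mem hb
          refine ⟨b, hb, hb1, Finset.mem_erase.2 ⟨?_, Finset.mem_erase.2 ⟨?_, hbZ⟩⟩⟩
          · rintro h; exact hCE (e1.1 (h ▸ hbE))
          · rintro h; exact hCE (h ▸ hbE))
    obtain ⟨u, hu, hu'⟩ := exists_mk_eq_mk_inv_eq hinv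
    refine ⟨insert u (insert u⁻¹ S), ?_, ?_⟩
    · rw [Set.inv_insert, Set.inv_insert, inv_inv, hS, Set.insert_comm]
    · have h1 := hbij.insert (a := u⁻¹) (by simp [hu'])
      have h2 := h1.insert (a := u) (by simp [hu, hu', hne.symm])
      convert h2 using 1
      rw [hu, hu', ← Finset.coe_insert, ← Finset.coe_insert, Finset.insert_erase hC'',
        Finset.insert_erase hC]
  by_cases hE : (cosetDoubleCoset H C₀)⁻¹ = cosetDoubleCoset H C₀
  · by_cases ho : Odd (Z.filter fun D => cosetDoubleCoset H D = cosetDoubleCoset H C₀).card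
    -- An odd count is made even by letting `b = b⁻¹` represent its own coset.
    · obtain ⟨b, hb, hb1, hbZ⟩ := hodd _ hE ho
      have hbE := cosetDoubleCoset_eq_of_mem hb
      have hbinv : b⁻¹ = b := inv_eq_of_mul_eq_one_left hb1
      have hcount : ∀ E : Set G,
          ((Z.erase (b : G ⧸ H)).filter fun D => cosetDoubleCoset H D = E).card +
            (if cosetDoubleCoset H C₀ = E then 1 else 0) =
          (Z.filter fun D => cosetDoubleCoset H D = E).card := by
        intro E
        rw [← hbE, card_filter_erase_add _ hbZ]
      obtain ⟨S, hS, hbij⟩ := ih _ (by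
          rw [Finset.card_erase_of_mem hbZ, hZn]
          have : 0 < Z.card := Finset.card_pos.2 ⟨_, hC₀⟩
          omega) (Z.erase (b : G ⧸ H)) rfl (by
          intro E
          have h1 := hcount E
          have h2 := hcount E⁻¹
          have h3 := hbal E
          have e : cosetDoubleCoset H C₀ = E⁻¹ ↔ cosetDoubleCoset H C₀ = E := by
            rw [← inv_eq_iff_eq_inv, hE]
          simp only [e] at h2
          omega) (by
          intro E hE' ho'
          have h1 := hcount E
          by_cases hCE : cosetDoubleCoset H C₀ = E
          · rw [if_pos hCE] at h1
            rw [hCE, ← h1] at ho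
            exfalso
            grind
          · rw [if_neg hCE, add_zero] at h1
            obtain ⟨c, hc, hc1, hcZ⟩ := hodd E hE' (h1 ▸ ho')
            obtain ⟨D, hD⟩ := mem_of_odd _ _ ho'
            have hcE : cosetDoubleCoset H (c : G ⧸ H) = E := by
              rw [← hD] at hc ⊢
              exact cosetDoubleCoset_eq_of_mem hc
            refine ⟨c, hc, hc1, Finset.mem_erase.2 ⟨?_, hcZ⟩⟩
            rintro h
            exact hCE (by rw [← hbE, ← h, hcE]))
      refine ⟨insert b S, ?_, ?_⟩
      · rw [Set.inv_insert, hS, hbinv]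
      · have h1 := hbij.insert (a := b) (by simp)
        convert h1 using 1
        rw [← Finset.coe_insert, Finset.insert_erase hbZ]
    · rw [Nat.not_odd_iff_even] at ho
      have hmem : C₀ ∈ Z.filter fun D => cosetDoubleCoset H D = cosetDoubleCoset H C₀ :=
        Finset.mem_filter.2 ⟨hC₀, rfl⟩
      have hpos := Finset.card_pos.2 ⟨_, hmem⟩
      obtain ⟨C', hC', hne⟩ := Finset.exists_mem_ne (s := Z.filter fun D =>
        cosetDoubleCoset H D = cosetDoubleCoset H C₀) (by
        rcases ho with ⟨k, hk⟩
        omega) C₀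
      rw [Finset.mem_filter] at hC'
      exact remove_pair C₀ hC₀ C' hC'.1 hne (by rw [hE, hC'.2]) fun _ => ho
  · have hpos : 0 < (Z.filter fun D => cosetDoubleCoset H D = (cosetDoubleCoset H C₀)⁻¹).card := by
      rw [← hbal]
      exact Finset.card_pos.2 ⟨C₀, Finset.mem_filter.2 ⟨hC₀, rfl⟩⟩
    obtain ⟨C', hC'⟩ := Finset.card_pos.1 hpos
    rw [Finset.mem_filter] at hC'
    refine remove_pair C₀ hC₀ C' hC'.1 ?_ hC'.2 fun h => absurd (hC'.2 ▸ h) hE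
    rintro rfl
    exact hE hC'.2.symm

/-! ### Perfect codes in terms of double cosets. -/

section PerfectCodes

variable {G : Type*} [Group G]

lemma mk_eq_mk_one_iff {H : Subgroup G} {g : G} : (g : G ⧸ H) = ((1 : G) : G ⧸ H) ↔ g ∈ H := by
  rw [eq_comm, QuotientGroup.eq]
  simp

lemma mem_doubleCoset_one_iff {H : Subgroup G} {g : G} :
    g ∈ doubleCoset (1 : G) (H : Set G) H ↔ g ∈ H := by
  rw [mem_doubleCoset]
  constructor
  · rintro ⟨x, hx, y, hy, rfl⟩
    simpa using H.mul_mem hx hy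
  · intro hg
    exact ⟨g, hg, 1, H.one_mem, by simp⟩

lemma doubleCoset_eq_one_iff {H : Subgroup G} {g : G} :
    doubleCoset g (H : Set G) H = doubleCoset 1 (H : Set G) H ↔ g ∈ H := by
  rw [← mem_doubleCoset_one_iff]
  exact ⟨fun h => h ▸ mem_doubleCoset_self H H g, doubleCoset_eq_of_mem⟩

open Classical in
/-- A subgroup is a perfect code if every self-inverse nontrivial double coset made up of an odd
number of left cosets contains an involution. -/
theorem isPerfectCode_of_doubleCoset [Finite G] (H : Subgroup G)
    (h : ∀ g, g ∉ H → g⁻¹ ∈ doubleCoset g (H : Set G) H →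
      Odd (Nat.card {C : G ⧸ H // cosetDoubleCoset H C = doubleCoset g (H : Set G) H}) →
      ∃ b ∈ doubleCoset g (H : Set G) H, b * b = 1) :
    IsPerfectCode (H : Set G) := by
  have : Fintype (G ⧸ H) := Fintype.ofFinite _
  set Z : Finset (G ⧸ H) := Finset.univ.erase ((1 : G) : G ⧸ H) with hZ
  have hZmem : ∀ g : G, (g : G ⧸ H) ∈ Z ↔ g ∉ H := by
    intro g
    rw [hZ, Finset.mem_erase, Ne, mk_eq_mk_one_iff]
    simp
  have hcount : ∀ E : Set G, (Z.filter fun C => cosetDoubleCoset H C = E).card +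
      (if doubleCoset (1 : G) (H : Set G) H = E then 1 else 0) =
      Nat.card {C : G ⧸ H // cosetDoubleCoset H C = E} := by
    intro E
    rw [Nat.card_eq_fintype_card, Fintype.card_subtype,
      ← card_filter_erase_add _ (Finset.mem_univ ((1 : G) : G ⧸ H))]
    rfl
  obtain ⟨S, hS, hbij⟩ := exists_inv_closed_representatives H _ Z rfl (by
      intro E
      have h1 := hcount E
      have h2 := hcount E⁻¹
      have h3 := card_cosets_inv H E
      have e : doubleCoset (1 : G) (H : Set G) H = E⁻¹ ↔ doubleCoset (1 : G) (H : Set G) H = E := by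
        rw [← inv_eq_iff_eq_inv, ← doubleCoset_inv, inv_one]
      simp only [e] at h2
      omega) (by
      intro E hE ho
      obtain ⟨C, hC⟩ := Finset.card_pos.1 ho.pos
      rw [Finset.mem_filter] at hC
      induction C using QuotientGroup.induction_on with | H g =>
      obtain ⟨hg, rfl⟩ := hC
      rw [hZmem] at hg
      rw [cosetDoubleCoset_mk] at hE ho
      have h1 := hcount (doubleCoset g (H : Set G) H)
      have hg1 : ¬ doubleCoset (1 : G) (H : Set G) H = doubleCoset g (H : Set G) H :=
        fun e => hg (doubleCoset_eq_one_iff.1 e.symm)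
      rw [if_neg hg1, add_zero] at h1
      obtain ⟨b, hb, hb1⟩ := h g hg (by
        rw [← hE, Set.mem_inv, inv_inv]
        exact mem_doubleCoset_self H H g) (h1 ▸ ho)
      refine ⟨b, hb, hb1, (hZmem b).2 fun hbH => hg1 ?_⟩
      rw [← doubleCoset_eq_of_mem hb, doubleCoset_eq_one_iff.2 hbH])
  have hSH : ∀ s ∈ S, s ∉ H := fun s hs => (hZmem s).1 (hbij.mapsTo hs)
  -- A neighbour `c ∈ H` of `v` amounts to a representative `v c⁻¹ ∈ S` of `vH`, which exists and is
  -- unique.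
  refine ⟨S, fun h1 => hSH 1 h1 H.one_mem, hS, ?_, ?_⟩
  · intro x hx y hy hadj
    exact hSH _ hadj (H.mul_mem hy (H.inv_mem hx))
  · intro v hv
    obtain ⟨s, hs, hsv⟩ := hbij.surjOn ((hZmem v).2 hv)
    have hsv' : s⁻¹ * v ∈ H := QuotientGroup.eq.1 hsv
    refine ⟨s⁻¹ * v, ⟨hsv', ?_⟩, ?_⟩
    · change s⁻¹ * v * v⁻¹ ∈ S
      rw [mul_inv_cancel_right, ← hS, Set.mem_inv, inv_inv]
      exact hs
    · rintro c ⟨hc, hcv⟩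
      change c * v⁻¹ ∈ S at hcv
      have hcv' : v * c⁻¹ ∈ S := by
        rw [← hS, Set.mem_inv]
        simpa using hcv
      have : v * c⁻¹ = s := hbij.injOn hcv' hs (by
        change (s : G ⧸ H) = (v : G ⧸ H) at hsv
        rw [hsv, QuotientGroup.eq]
        simpa using hc)
      rw [← this]
      group

lemma doubleCoset_inv_of_mul_self_mem {H : Subgroup G} {x : G} (hx : x * x ∈ H) :
    (doubleCoset x (H : Set G) H)⁻¹ = doubleCoset x (H : Set G) H := by
  rw [← doubleCoset_inv]
  exact doubleCoset_eq_of_mem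
    (mem_doubleCoset.2 ⟨(x * x)⁻¹, H.inv_mem hx, 1, H.one_mem, by simp⟩)

/-- If a subgroup is a perfect code, each self-inverse nontrivial double coset made up of an odd
number of left cosets contains an involution. -/
theorem IsPerfectCode.exists_mul_self_eq_one [Finite G] {H : Subgroup G}
    (hH : IsPerfectCode (H : Set G)) {x : G} (hx : x ∉ H) (hxx : x * x ∈ H)
    (ho : Odd (Nat.card {C : G ⧸ H // cosetDoubleCoset H C = doubleCoset x (H : Set G) H})) :
    ∃ h ∈ H, (h * x) * (h * x) = 1 := by
  classical
  obtain ⟨S, h_one, hS, -, hcode⟩ := hH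
  have hinv : ∀ s ∈ S, s⁻¹ ∈ S := fun s hs => by rwa [← hS, Set.inv_mem_inv]
  set D := doubleCoset x (H : Set G) H with hD
  have hDinv : D⁻¹ = D := doubleCoset_inv_of_mul_self_mem hxx
  have hDH : ∀ d ∈ D, d ∉ H := fun d hd hdH => hx (doubleCoset_eq_one_iff.1
    ((doubleCoset_eq_of_mem hd).symm.trans (doubleCoset_eq_one_iff.2 hdH)))
  -- The code property makes `S ∩ D` a set of representatives of the cosets in `D`. It therefore has
  -- odd size, and inversion fixes one of its elements.
  let f : {s : G // s ∈ S ∧ s ∈ D} → {C : G ⧸ H // cosetDoubleCoset H C = D} :=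
    fun s => ⟨(s.1 : G ⧸ H), doubleCoset_eq_of_mem s.2.2⟩
  have hf : Function.Bijective f := by
    constructor
    · rintro ⟨s, hs, hsD⟩ ⟨t, ht, htD⟩ hst
      have hst' : s⁻¹ * t ∈ H := QuotientGroup.eq.1 (congrArg Subtype.val hst)
      have := (hcode t (hDH t htD)).unique (y₁ := 1) (y₂ := s⁻¹ * t)
        ⟨H.one_mem, by change 1 * t⁻¹ ∈ S; simpa using hinv t ht⟩
        ⟨hst', by change s⁻¹ * t * t⁻¹ ∈ S; simpa using hinv s hs⟩
      exact Subtype.ext (inv_mul_eq_one.1 this.symm)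
    · rintro ⟨C, hC⟩
      induction C using QuotientGroup.induction_on with | H v =>
      have hvD : v ∈ D := by rw [← hC]; exact mem_doubleCoset_self H H v
      obtain ⟨c, ⟨hc, hcv⟩, -⟩ := hcode v (hDH v hvD)
      change c * v⁻¹ ∈ S at hcv
      have hmk : ((v * c⁻¹ : G) : G ⧸ H) = (v : G ⧸ H) := by
        rw [QuotientGroup.eq]
        simpa using hc
      refine ⟨⟨v * c⁻¹, by simpa using hinv _ hcv, ?_⟩, Subtype.ext hmk⟩
      rw [← hC, ← hmk]
      exact mem_doubleCoset_self H H _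
  have : Fintype {s : G // s ∈ S ∧ s ∈ D} := Fintype.ofFinite _
  rw [← Nat.card_congr (Equiv.ofBijective f hf), Nat.card_eq_fintype_card] at ho
  let σ : Equiv.Perm {s : G // s ∈ S ∧ s ∈ D} := (Equiv.inv G).subtypeEquiv fun s => by
    simp only [Equiv.inv_apply]
    rw [← Set.mem_inv, ← Set.mem_inv, hS, hDinv]
  obtain ⟨⟨s, hs, hsD⟩, hfix⟩ := Equiv.Perm.exists_fixed_point_of_prime (p := 2) (n := 1)
    ho.not_two_dvd_nat (σ := σ) (by ext s; simp [σ, sq])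
  have hs1 : s⁻¹ = s := congrArg Subtype.val hfix
  obtain ⟨h, hh, k, hk, rfl⟩ := mem_doubleCoset.1 hsD
  refine ⟨k * h, H.mul_mem hk hh, ?_⟩
  have : (h * x * k) * (h * x * k) = 1 := by
    nth_rewrite 1 [← hs1]
    exact inv_mul_cancel _
  calc k * h * x * (k * h * x) = k * ((h * x * k) * (h * x * k)) * k⁻¹ := by group
    _ = 1 := by rw [this]; group

/-- Orbit-stabilizer for `H` acting on `G ⧸ H`: the stabilizer of `xH` is `H ∩ xHx⁻¹`. -/
lemma card_cosets_eq_relIndex [Finite G] (H : Subgroup G) (x : G) :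
    Nat.card {C : G ⧸ H // cosetDoubleCoset H C = doubleCoset x (H : Set G) H} =
      (MulAut.conj x • H).relIndex H := by
  have h1 : MulAction.orbit H (x : G ⧸ H) =
      {C : G ⧸ H | cosetDoubleCoset H C = doubleCoset x (H : Set G) H} := by
    ext C
    induction C using QuotientGroup.induction_on with | H g =>
    rw [Set.mem_ofPred_eq, cosetDoubleCoset_mk]
    constructor
    · rintro ⟨h, hh⟩
      have : ((h * x : G) : G ⧸ H) = (g : G ⧸ H) := hh
      rw [QuotientGroup.eq] at this
      exact doubleCoset_eq_of_mem (mem_doubleCoset.2 ⟨h, h.2, _, this, by group⟩)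
    · intro h
      have hg : g ∈ doubleCoset x (H : Set G) H := h ▸ mem_doubleCoset_self H H g
      obtain ⟨a, ha, b, hb, rfl⟩ := mem_doubleCoset.1 hg
      refine ⟨⟨a, ha⟩, ?_⟩
      change ((a * x : G) : G ⧸ H) = _
      rw [QuotientGroup.eq]
      simpa [mul_assoc] using hb
  have h2 : MulAction.stabilizer H (x : G ⧸ H) = (MulAut.conj x • H).subgroupOf H := by
    ext h
    rw [MulAction.mem_stabilizer_iff, Subgroup.mem_subgroupOf,
      Subgroup.mem_pointwise_smul_iff_inv_smul_mem]
    change ((h * x : G) : G ⧸ H) = _ ↔ _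
    rw [eq_comm, QuotientGroup.eq, ← map_inv, MulAut.smul_def, MulAut.conj_apply, inv_inv,
      mul_assoc]
  rw [Subgroup.relIndex, ← h2, MulAction.index_stabilizer, h1]
  rfl

end PerfectCodes

/-! ### Sylow arguments: reduction to the normalizer of `Q`. -/

section Sylow

variable {G : Type*} [Group G]

lemma mem_conj_smul {H : Subgroup G} {x y : G} : y ∈ MulAut.conj x • H ↔ x⁻¹ * y * x ∈ H := by
  rw [Subgroup.mem_pointwise_smul_iff_inv_smul_mem, ← map_inv, MulAut.smul_def, MulAut.conj_apply,
    inv_inv]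

lemma conj_smul_eq_of_le [Finite G] {x : G} {Q : Subgroup G} (h : ∀ q ∈ Q, x * q * x⁻¹ ∈ Q) :
    MulAut.conj x • Q = Q := by
  refine Subgroup.eq_of_le_of_card_ge ?_
    (Nat.card_congr (Subgroup.equivSMul (MulAut.conj x) Q).toEquiv).le
  intro y hy
  have := h _ (mem_conj_smul.1 hy)
  simpa [mul_assoc] using this

lemma le_normalizer_of_conj_smul_eq {x : G} {Q : Subgroup G} (h : MulAut.conj x • Q = Q) :
    Subgroup.zpowers x ≤ Subgroup.normalizer (Q : Set G) := by
  rw [Subgroup.zpowers_le, Subgroup.mem_normalizer_iff]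
  intro y
  nth_rewrite 2 [← h]
  rw [mem_conj_smul]
  simp [mul_assoc]

lemma conj_mem_of_conj_smul_eq {x q : G} {Q : Subgroup G} (h : MulAut.conj x • Q = Q)
    (hq : q ∈ Q) : x * q * x⁻¹ ∈ Q := by
  rw [← h, mem_conj_smul]
  simpa [mul_assoc] using hq

lemma isPGroup_zpowers {x : G} {k : ℕ} (hx : x ^ 2 ^ k = 1) :
    IsPGroup 2 (Subgroup.zpowers x) := by
  have : Fact (Nat.Prime 2) := ⟨Nat.prime_two⟩
  obtain ⟨j, -, hj⟩ := (Nat.dvd_prime_pow Nat.prime_two).1 (orderOf_dvd_of_pow_eq_one hx)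
  exact IsPGroup.of_card (n := j) (by rw [Nat.card_zpowers, hj])

lemma exists_sylow_eq_comap {M Q : Subgroup G} (hQ : IsPGroup 2 Q) (hQM : ¬ 2 ∣ Q.relIndex M) :
    ∃ S : Sylow 2 M, (S : Subgroup M) = Q.comap M.subtype := by
  have : Fact (Nat.Prime 2) := ⟨Nat.prime_two⟩
  have hQM' : ¬ 2 ∣ (Q.comap M.subtype).index := hQM
  exact ⟨(hQ.comap_subtype (K := M)).toSylow hQM', IsPGroup.toSylow_coe _ _⟩

/-- The second Sylow theorem inside a subgroup `M`. -/
lemma exists_le_conj_smul [Finite G] {M Q P : Subgroup G} (hQ : IsPGroup 2 Q)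
    (hQM : ¬ 2 ∣ Q.relIndex M) (hP : IsPGroup 2 P) (hPM : P ≤ M) :
    ∃ m ∈ M, P ≤ MulAut.conj m • Q := by
  have : Fact (Nat.Prime 2) := ⟨Nat.prime_two⟩
  obtain ⟨R, hR⟩ := (hP.comap_subtype (K := M)).exists_le_sylow
  obtain ⟨S, hS⟩ := exists_sylow_eq_comap hQ hQM
  obtain ⟨m, hm⟩ := MulAction.exists_smul_eq M S R
  refine ⟨m, m.2, fun p hp => ?_⟩
  have h1 : (⟨p, hPM hp⟩ : M) ∈ (R : Subgroup M) := hR (Subgroup.mem_comap.2 hp)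
  rw [← hm, Sylow.coe_subgroup_smul, mem_conj_smul, hS, Subgroup.mem_comap] at h1
  rw [mem_conj_smul]
  simpa using h1

/-- `Q⟨y⟩` is a 2-subgroup of `H`, so it cannot exceed the Sylow subgroup `Q`. -/
lemma mem_of_conj_smul_eq [Finite G] {H Q : Subgroup G} (hQH : Q ≤ H) (hQ : IsPGroup 2 Q)
    (hind : ¬ 2 ∣ Q.relIndex H) {y : G} (hy : y ∈ H) (hyQ : MulAut.conj y • Q = Q) {k : ℕ}
    (hk : y ^ 2 ^ k = 1) : y ∈ Q := by
  have hE : IsPGroup 2 (Q ⊔ Subgroup.zpowers y : Subgroup G) :=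
    hQ.to_sup_of_normal_left' (isPGroup_zpowers hk) (le_normalizer_of_conj_smul_eq hyQ)
  obtain ⟨m, -, hle⟩ := exists_le_conj_smul hQ hind hE
    (sup_le hQH ((Subgroup.zpowers_le).2 hy))
  have hcard : Nat.card (Q ⊔ Subgroup.zpowers y : Subgroup G) ≤ Nat.card Q := by
    rw [Nat.card_congr (Subgroup.equivSMul (MulAut.conj m) Q).toEquiv]
    exact Subgroup.card_le_of_le hle
  rw [Subgroup.eq_of_le_of_card_ge le_sup_left hcard]
  exact Subgroup.mem_sup_right (Subgroup.mem_zpowers y)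

/-- An involution normalizing `K` normalizes, up to conjugation in `K`, a given Sylow `2`-subgroup
of `K`. -/
lemma exists_conj_smul_eq_of_mul_self_eq_one [Finite G] {K Q : Subgroup G} (hQK : Q ≤ K)
    (hQ : IsPGroup 2 Q) (hind : ¬ 2 ∣ Q.relIndex K) {t : G} (ht : t * t = 1)
    (htK : MulAut.conj t • K = K) :
    ∃ k ∈ K, MulAut.conj (k⁻¹ * t * k) • Q = Q := by
  have : Fact (Nat.Prime 2) := ⟨Nat.prime_two⟩
  let φ : MulAut K :=
    (Subgroup.equivSMul (MulAut.conj t) K).trans (MulEquiv.subgroupCongr htK)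
  have hφ : ∀ k : K, ((φ k : K) : G) = t * k * t⁻¹ := fun k => rfl
  have hφφ : φ ^ 2 = 1 := by
    ext k
    rw [sq, MulAut.mul_apply, hφ, hφ, MulAut.one_apply]
    have : t⁻¹ = t := inv_eq_of_mul_eq_one_left ht
    rw [this]
    calc t * (t * k * t) * t = (t * t) * k * (t * t) := by group
      _ = k := by rw [ht]; simp
  have : Fintype (Sylow 2 K) := Fintype.ofFinite _
  -- The number of Sylow 2-subgroups is odd, so a permutation of them with trivial square fixes one.
  obtain ⟨P, hP⟩ := Equiv.Perm.exists_fixed_point_of_prime (p := 2) (n := 1)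
    (by rw [← Nat.card_eq_fintype_card]; exact not_dvd_card_sylow 2 K)
    (σ := MulAction.toPermHom (MulAut K) (Sylow 2 K) φ)
    (by rw [pow_one, ← map_pow, hφφ, map_one])
  have hP' : φ • P = P := hP
  obtain ⟨S, hS⟩ := exists_sylow_eq_comap hQ hind
  obtain ⟨k, hk⟩ := MulAction.exists_smul_eq K S P
  have hmem : ∀ g : K, g ∈ (P : Subgroup K) ↔ (k : G)⁻¹ * g * k ∈ Q := by
    intro g
    rw [← hk, Sylow.coe_subgroup_smul, mem_conj_smul, hS, Subgroup.mem_comap]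
    simp
  refine ⟨k, k.2, conj_smul_eq_of_le fun q hq => ?_⟩
  have h1 : k * ⟨q, hQK hq⟩ * k⁻¹ ∈ (P : Subgroup K) := by
    rw [hmem]
    simpa [mul_assoc] using hq
  have h2 : φ (k * ⟨q, hQK hq⟩ * k⁻¹) ∈ (P : Subgroup K) := by
    rw [← hP', Sylow.pointwise_smul_def]
    exact Subgroup.smul_mem_pointwise_smul _ φ _ h1
  rw [hmem, hφ] at h2
  simpa [mul_assoc] using h2

lemma odd_card_cosets_of_le [Finite G] {H Q : Subgroup G} {x : G} (hQH : Q ≤ H)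
    (hind : ¬ 2 ∣ Q.relIndex H) (hQx : Q ≤ MulAut.conj x • H) :
    Odd (Nat.card {C : G ⧸ H // cosetDoubleCoset H C = doubleCoset x (H : Set G) H}) := by
  rw [card_cosets_eq_relIndex, ← Nat.not_even_iff_odd, even_iff_two_dvd]
  intro h
  refine hind ?_
  rw [← Subgroup.relIndex_mul_relIndex Q (H ⊓ MulAut.conj x • H) H (le_inf hQH hQx) inf_le_left,
    Subgroup.inf_relIndex_left]
  exact h.mul_left _

/-- A subgroup `H` with Sylow `2`-subgroup `Q` is a perfect code if each `x` normalizing `Q` with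
`x² ∈ Q` has an involution in its coset `x Q`. -/
theorem isPerfectCode_of_normalizer [Finite G] {H Q : Subgroup G} (hQH : Q ≤ H)
    (hQ : IsPGroup 2 Q) (hind : ¬ 2 ∣ Q.relIndex H)
    (h : ∀ x : G, MulAut.conj x • Q = Q → x * x ∈ Q → (∃ k, x ^ 2 ^ k = 1) →
      ∃ q ∈ Q, (x * q) * (x * q) = 1) :
    IsPerfectCode (H : Set G) := by
  have : Fact (Nat.Prime 2) := ⟨Nat.prime_two⟩
  refine isPerfectCode_of_doubleCoset H fun g hg hginv ho => ?_
  obtain ⟨a, ha, b, hb, hab⟩ := mem_doubleCoset.1 hginv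
  -- From `g⁻¹ = a g b`, the representative `g b` of the double coset has square `a⁻¹ b`.
  have hsq : (g * b) * (g * b) ∈ H := by
    have : (g * b) * (g * b) = a⁻¹ * b := by
      calc (g * b) * (g * b) = a⁻¹ * (a * g * b) * g * b := by group
        _ = a⁻¹ * b := by rw [← hab]; group
    rw [this]
    exact H.mul_mem (H.inv_mem ha) hb
  have hD : g * b ∈ doubleCoset g (H : Set G) H :=
    mem_doubleCoset.2 ⟨1, H.one_mem, b, hb, by simp⟩
  rw [← doubleCoset_eq_of_mem hD] at ho ⊢
  generalize g * b = x at hsq ho ⊢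
  have hmemD : ∀ u ∈ H, ∀ v ∈ H, u * x * v ∈ doubleCoset x (H : Set G) H :=
    fun u hu v hv => mem_doubleCoset.2 ⟨u, hu, v, hv, rfl⟩
  -- after conjugating in `H`, we may assume that `Q ≤ x H x⁻¹`
  have hstep : ∃ u ∈ H, Q ≤ MulAut.conj (u * x * u⁻¹) • H := by
    rw [card_cosets_eq_relIndex] at ho
    set K := H ⊓ MulAut.conj x • H with hK
    obtain ⟨P⟩ : Nonempty (Sylow 2 K) := inferInstance
    have hPK : P.1.map K.subtype ≤ K := Subgroup.map_subtype_le _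
    have hPi : ¬ 2 ∣ (P.1.map K.subtype).relIndex K := by
      rw [Subgroup.relIndex, Subgroup.subgroupOf,
        Subgroup.comap_map_eq_self_of_injective K.subtype_injective]
      exact P.not_dvd_index
    have hPH : ¬ 2 ∣ (P.1.map K.subtype).relIndex H := by
      rw [← Subgroup.relIndex_mul_relIndex _ K H hPK inf_le_left, Subgroup.inf_relIndex_left,
        Nat.prime_two.dvd_mul]
      exact not_or.2 ⟨hPi, ho.not_two_dvd_nat⟩
    obtain ⟨u, hu, hle⟩ := exists_le_conj_smul (P.2.map K.subtype) hPH hQ hQH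
    refine ⟨u, hu, fun q hq => ?_⟩
    have h1 := hPK (mem_conj_smul.1 (hle hq))
    have h2 := mem_conj_smul.1 (Subgroup.mem_inf.1 h1).2
    rw [mem_conj_smul]
    have h3 := H.mul_mem (H.mul_mem hu h2) (H.inv_mem hu)
    convert h3 using 1
    group
  obtain ⟨u, hu, hQu⟩ := hstep
  have hsqu : (u * x * u⁻¹) * (u * x * u⁻¹) ∈ H := by
    have := H.mul_mem (H.mul_mem hu hsq) (H.inv_mem hu)
    convert this using 1
    group
  have hD1 := hmemD u hu u⁻¹ (H.inv_mem hu)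
  rw [← doubleCoset_eq_of_mem hD1]
  clear hmemD hD1 ho hsq hu
  generalize u * x * u⁻¹ = x at hQu hsqu ⊢
  -- after multiplying with an element of `H ∩ x H x⁻¹`, we may assume that `x` normalizes `Q`
  have hconj : ∀ y ∈ H ⊓ MulAut.conj x • H, x * y * x⁻¹ ∈ H ⊓ MulAut.conj x • H := by
    intro y hy
    obtain ⟨hyH, hyx⟩ := Subgroup.mem_inf.1 hy
    refine Subgroup.mem_inf.2 ⟨?_, ?_⟩
    · have := H.mul_mem (H.mul_mem hsqu (mem_conj_smul.1 hyx)) (H.inv_mem hsqu)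
      convert this using 1
      group
    · rw [mem_conj_smul]
      convert hyH using 1
      group
  have hQK : ¬ 2 ∣ Q.relIndex (H ⊓ MulAut.conj x • H) := fun hdvd => hind (by
    rw [← Subgroup.relIndex_mul_relIndex Q (H ⊓ MulAut.conj x • H) H (le_inf hQH hQu) inf_le_left]
    exact hdvd.mul_right _)
  -- As `x² ∈ H`, `x` normalizes `H ∩ xHx⁻¹`; so `Q` and `xQx⁻¹` are both Sylow there and `k`
  -- conjugates one to the other.
  obtain ⟨k, hk, hle⟩ := exists_le_conj_smul (P := MulAut.conj x • Q) hQ hQK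
    (hQ.of_equiv (Subgroup.equivSMul (MulAut.conj x) Q)) (by
      intro y hy
      have := hconj _ (le_inf hQH hQu (mem_conj_smul.1 hy))
      convert this using 1
      group)
  have hkH : k ∈ H := (Subgroup.mem_inf.1 hk).1
  have hnorm : MulAut.conj (k⁻¹ * x) • Q = Q := by
    refine conj_smul_eq_of_le fun q hq => ?_
    have h1 : x * q * x⁻¹ ∈ MulAut.conj x • Q := by
      rw [mem_conj_smul]
      convert hq using 1
      group
    have := mem_conj_smul.1 (hle h1)
    convert this using 1
    group
  have hsqk : (k⁻¹ * x) * (k⁻¹ * x) ∈ H := by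
    have h1 := (Subgroup.mem_inf.1 (hconj _ (inv_mem hk))).1
    have := H.mul_mem (H.mul_mem (H.inv_mem hkH) h1) hsqu
    convert this using 1
    group
  have hD2 : k⁻¹ * x ∈ doubleCoset x (H : Set G) H :=
    mem_doubleCoset.2 ⟨k⁻¹, H.inv_mem hkH, 1, H.one_mem, by simp⟩
  rw [← doubleCoset_eq_of_mem hD2]
  clear hD2 hle hQK hconj hk hkH
  generalize k⁻¹ * x = x at hnorm hsqk ⊢
  -- an odd power of `x` is a `2`-element
  obtain ⟨e, m, ⟨j, rfl⟩, hem⟩ := Nat.exists_eq_two_pow_mul_odd (orderOf_pos x).ne'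
  have hy : x ^ (2 * j + 1) = x * (x * x) ^ j := by
    rw [pow_succ', pow_mul, sq]
  have hyD : ∀ q ∈ Q, x ^ (2 * j + 1) * q ∈ doubleCoset x (H : Set G) H := fun q hq =>
    mem_doubleCoset.2 ⟨1, H.one_mem, (x * x) ^ j * q, H.mul_mem (H.pow_mem hsqk j) (hQH hq), by
      rw [hy]; group⟩
  have hynorm : MulAut.conj (x ^ (2 * j + 1)) • Q = Q := by
    rw [map_pow, ← MulAction.mem_stabilizer_iff]
    exact pow_mem (MulAction.mem_stabilizer_iff.2 hnorm) _
  have hypow : (x ^ (2 * j + 1)) ^ 2 ^ e = 1 := by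
    rw [← pow_mul, mul_comm, ← hem, pow_orderOf_eq_one]
  have hyH : x ^ (2 * j + 1) * x ^ (2 * j + 1) ∈ H := by
    have : x ^ (2 * j + 1) * x ^ (2 * j + 1) = (x * x) ^ (2 * j + 1) :=
      ((Commute.refl x).mul_pow _).symm
    rw [this]
    exact H.pow_mem hsqk _
  obtain ⟨q, hq, hq1⟩ := h (x ^ (2 * j + 1)) hynorm
    (mem_of_conj_smul_eq hQH hQ hind hyH (by rw [map_mul, mul_smul, hynorm, hynorm]) (k := e) (by
      rw [((Commute.refl _).mul_pow _), hypow, one_mul])) ⟨e, hypow⟩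
  exact ⟨_, hyD q hq, hq1⟩

end Sylow

/-! ### Groups whose involution centralizers have cyclic tori. -/

section Involutions

/-- A cyclic group has at most `n` solutions of `bⁿ = 1`; with `n = orderOf c`, the powers of `c`
already supply all of them. -/
lemma mem_zpowers_of_orderOf_dvd {A : Type*} [Group A] [Finite A] [IsCyclic A] {a c : A}
    (h : orderOf a ∣ orderOf c) : a ∈ Subgroup.zpowers c := by
  classical
  have : Fintype A := Fintype.ofFinite _
  have hsub : (Subgroup.zpowers c : Set A).toFinset ⊆
      Finset.univ.filter fun b : A => b ^ orderOf c = 1 := by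
    intro b hb
    rw [Set.mem_toFinset] at hb
    obtain ⟨k, rfl⟩ := Subgroup.mem_zpowers_iff.1 hb
    rw [Finset.mem_filter]
    refine ⟨Finset.mem_univ _, ?_⟩
    rw [← zpow_natCast, ← zpow_mul, mul_comm, zpow_mul, zpow_natCast, pow_orderOf_eq_one, one_zpow]
  have hcard : (Subgroup.zpowers c : Set A).toFinset.card = orderOf c := by
    rw [Set.toFinset_card, ← Nat.card_eq_fintype_card]
    exact Nat.card_zpowers c
  have heq := Finset.eq_of_subset_of_card_le hsub
    (by rw [hcard]; exact IsCyclic.card_pow_eq_one_le (orderOf_pos c))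
  have ha : a ∈ Finset.univ.filter fun b : A => b ^ orderOf c = 1 :=
    Finset.mem_filter.2 ⟨Finset.mem_univ _, orderOf_dvd_iff_pow_eq_one.1 h⟩
  rw [← heq, Set.mem_toFinset] at ha
  exact ha

variable {G : Type*} [Group G]

lemma orderOf_eq_two_of_mul_self {z : G} (hz : z * z = 1) (hz1 : z ≠ 1) : orderOf z = 2 :=
  orderOf_eq_prime (by rw [sq, hz]) hz1

lemma two_dvd_orderOf {g : G} (hg : g ≠ 1) {k : ℕ} (hk : g ^ 2 ^ k = 1) : 2 ∣ orderOf g := by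
  obtain ⟨j, -, hj⟩ := (Nat.dvd_prime_pow Nat.prime_two).1 (orderOf_dvd_of_pow_eq_one hk)
  rcases j with _ | j
  · exact absurd (orderOf_eq_one_iff.1 (by simpa using hj)) hg
  · rw [hj, pow_succ]
    exact dvd_mul_left _ _

variable [Finite G]

lemma mem_zpowers_of_mem_isCyclic {T : Subgroup G} (hT : IsCyclic T) {a c : G} (ha : a ∈ T)
    (hc : c ∈ T) (h : orderOf a ∣ orderOf c) : a ∈ Subgroup.zpowers c := by
  have : (⟨a, ha⟩ : T) ∈ Subgroup.zpowers (⟨c, hc⟩ : T) :=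
    mem_zpowers_of_orderOf_dvd (by rwa [Subgroup.orderOf_mk, Subgroup.orderOf_mk])
  obtain ⟨k, hk⟩ := Subgroup.mem_zpowers_iff.1 this
  exact Subgroup.mem_zpowers_iff.2 ⟨k, congrArg Subtype.val hk⟩

lemma eq_of_mul_self_eq_one {T : Subgroup G} (hT : IsCyclic T) {a b : G} (ha : a ∈ T)
    (hb : b ∈ T) (ha1 : a * a = 1) (hb1 : b * b = 1) (ha' : a ≠ 1) (hb' : b ≠ 1) : a = b := by
  obtain ⟨k, rfl⟩ := Subgroup.mem_zpowers_iff.1 (mem_zpowers_of_mem_isCyclic hT ha hb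
    (by rw [orderOf_eq_two_of_mul_self ha1 ha', orderOf_eq_two_of_mul_self hb1 hb']))
  obtain ⟨j, rfl | rfl⟩ := Int.even_or_odd' k
  · exact absurd (by rw [zpow_mul, zpow_two, hb1, one_zpow]) ha'
  · rw [zpow_add, zpow_mul, zpow_two, hb1, one_zpow, one_mul, zpow_one]

lemma exists_central_involution {P : Subgroup G} (hP : IsPGroup 2 P) (hP1 : P ≠ ⊥) :
    ∃ z ∈ P, z * z = 1 ∧ z ≠ 1 ∧ ∀ p ∈ P, p * z = z * p := by
  have : Fact (Nat.Prime 2) := ⟨Nat.prime_two⟩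
  have : Nontrivial P := (Subgroup.nontrivial_iff_ne_bot P).2 hP1
  have := hP.center_nontrivial
  have hdvd : 2 ∣ Nat.card (Subgroup.center P) :=
    (hP.to_subgroup (Subgroup.center P)).card_eq_or_dvd.resolve_left
      (Finite.one_lt_card).ne'
  obtain ⟨z, hz⟩ := exists_prime_orderOf_dvd_card' 2 hdvd
  have hz' : orderOf ((z : P) : G) = 2 := by rw [Subgroup.orderOf_coe, Subgroup.orderOf_coe, hz]
  refine ⟨(z : P), (z : P).2, ?_, ?_, fun p hp => ?_⟩
  · rw [← sq, ← hz', pow_orderOf_eq_one]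
  · intro h
    rw [h, orderOf_one] at hz'
    omega
  · exact congrArg Subtype.val (Subgroup.mem_center_iff.1 z.2 ⟨p, hp⟩)

/-- The subgroup `T` is a cyclic subgroup such that all elements of the centralizer of `z` lying
outside of `T` are involutions. -/
structure IsCyclicTorus (z : G) (T : Subgroup G) : Prop where
  isCyclic : IsCyclic T
  mul_self : ∀ x, x * z = z * x → x ∉ T → x * x = 1

/-- Let `z` be a central involution of the 2-group `Q⟨x⟩`. If no element of `xQ` squares to 1, all
of `xQ` lies in the torus of `z`, so `Q⟨x⟩` is cyclic and the maximality of `Q` forces `x ∈ Q`. The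
maximality condition holds vacuously for noncyclic `Q`. -/
theorem isPerfectCode_of_torus (hD : ∀ z : G, z * z = 1 → z ≠ 1 → ∃ T, IsCyclicTorus z T)
    {H Q : Subgroup G} (hQH : Q ≤ H) (hQ : IsPGroup 2 Q) (hind : ¬ 2 ∣ Q.relIndex H)
    (h : Q = ⊥ ∨ ∀ C : Subgroup G, IsCyclic C → IsPGroup 2 C → Q ≤ C → C = Q) :
    IsPerfectCode (H : Set G) := by
  refine isPerfectCode_of_normalizer hQH hQ hind fun x hxQ hxx ⟨k, hk⟩ => ?_
  rcases h with rfl | h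
  · exact ⟨1, Subgroup.mem_bot.2 rfl, by simpa using hxx⟩
  by_cases hxmem : x ∈ Q
  · exact ⟨x⁻¹, Q.inv_mem hxmem, by simp⟩
  have hxP : x ∈ Q ⊔ Subgroup.zpowers x := Subgroup.mem_sup_right (Subgroup.mem_zpowers x)
  have hP : IsPGroup 2 (Q ⊔ Subgroup.zpowers x : Subgroup G) :=
    hQ.to_sup_of_normal_left' (isPGroup_zpowers hk) (le_normalizer_of_conj_smul_eq hxQ)
  obtain ⟨z, -, hz, hz1, hcomm⟩ := exists_central_involution hP (by
    intro hbot
    rw [hbot, Subgroup.mem_bot] at hxP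
    exact hxmem (hxP ▸ Q.one_mem))
  obtain ⟨T, hT⟩ := hD z hz hz1
  have hqP : ∀ q ∈ Q, x * q ∈ Q ⊔ Subgroup.zpowers x := fun q hq =>
    mul_mem hxP (Subgroup.mem_sup_left hq)
  by_contra! hcon
  have hmemT : ∀ q ∈ Q, x * q ∈ T := fun q hq => by
    by_contra hqT
    exact hcon q hq (hT.mul_self _ (hcomm _ (hqP q hq)) hqT)
  have hxT : x ∈ T := by simpa using hmemT 1 Q.one_mem
  have hPT : Q ⊔ Subgroup.zpowers x ≤ T := by
    refine sup_le (fun q hq => ?_) (Subgroup.zpowers_le.2 hxT)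
    simpa using T.mul_mem (T.inv_mem hxT) (hmemT q hq)
  have := hT.isCyclic
  rw [h _ (Subgroup.isCyclic_of_le hPT) hP le_sup_left] at hxP
  exact hxmem hxP

/-- A `2`-element whose order is not the largest one of a cyclic `2`-subgroup is a square. -/
lemma exists_mul_self_eq (hD : ∀ z : G, z * z = 1 → z ≠ 1 → ∃ T, IsCyclicTorus z T)
    (hS : ∀ z : G, z * z = 1 → z ≠ 1 → ∃ x, x * x = z) {g : G} (hg : g ≠ 1) {k : ℕ}
    (hk : g ^ 2 ^ k = 1) {C : Subgroup G} (hC : IsCyclic C) (hC2 : IsPGroup 2 C)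
    (hlt : orderOf g < Nat.card C) : ∃ x, x * x = g := by
  have : Fact (Nat.Prime 2) := ⟨Nat.prime_two⟩
  by_cases hgg : g * g = 1
  · exact hS g hgg hg
  obtain ⟨P, hgP⟩ := (isPGroup_zpowers hk).exists_le_sylow
  rw [Subgroup.zpowers_le] at hgP
  -- A conjugate `c` of a generator of `C` shares a Sylow subgroup with `g`. Both have order above 2
  -- and commute with a central involution, so both lie in its torus, where `g` is a power of `c²`.
  obtain ⟨m, -, hm⟩ := exists_le_conj_smul (M := ⊤) P.2
    (by rw [Subgroup.relIndex_top_right]; exact P.not_dvd_index) hC2 le_top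
  obtain ⟨⟨c₀, hc₀C⟩, hc₀⟩ := hC.exists_ofOrder_eq_natCard
  rw [Subgroup.orderOf_mk] at hc₀
  obtain ⟨c, hcP, hc⟩ : ∃ c ∈ P, orderOf c = Nat.card C := by
    refine ⟨m⁻¹ * c₀ * m, mem_conj_smul.1 (hm hc₀C), ?_⟩
    rw [← hc₀]
    have := MulEquiv.orderOf_eq (MulAut.conj m⁻¹) c₀
    rwa [MulAut.conj_apply, inv_inv] at this
  obtain ⟨z, -, hz, hz1, hcomm⟩ := exists_central_involution P.2 (by
    intro hbot
    have h1 : g ∈ (P : Subgroup G) := hgP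
    rw [hbot, Subgroup.mem_bot] at h1
    exact hg h1)
  obtain ⟨T, hT⟩ := hD z hz hz1
  have hgT : g ∈ T := by
    by_contra h
    exact hgg (hT.mul_self g (hcomm g hgP) h)
  have h2g := Nat.le_of_dvd (orderOf_pos g) (two_dvd_orderOf hg hk)
  have hcT : c ∈ T := by
    by_contra h
    have h1 := hT.mul_self c (hcomm c hcP) h
    have : orderOf c ≤ 2 := orderOf_le_of_pow_eq_one (by norm_num) (by rw [sq, h1])
    omega
  obtain ⟨i, -, hi⟩ := (Nat.dvd_prime_pow Nat.prime_two).1 (orderOf_dvd_of_pow_eq_one hk)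
  obtain ⟨j, hj⟩ := IsPGroup.iff_card.1 hC2
  rw [hi, hj] at hlt
  have hij := (Nat.pow_lt_pow_iff_right (by norm_num)).1 hlt
  obtain ⟨n, rfl⟩ : ∃ n, j = i + n + 1 := ⟨j - i - 1, by omega⟩
  have hord : orderOf (c ^ 2) = 2 ^ (i + n) := by
    rw [orderOf_pow, hc, hj, pow_succ, Nat.gcd_eq_right (dvd_mul_left _ _),
      Nat.mul_div_cancel _ (by norm_num)]
  obtain ⟨l, hl⟩ := Subgroup.mem_zpowers_iff.1 (mem_zpowers_of_mem_isCyclic hT.isCyclic hgT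
    (T.pow_mem hcT 2) (by rw [hi, hord]; exact pow_dvd_pow _ (by omega)))
  refine ⟨c ^ l, ?_⟩
  rw [← hl, ← zpow_add, ← zpow_natCast, ← zpow_mul]
  congr 1
  push_cast
  ring

/-- Since `x` centralizes `Q = ⟨x²⟩`, `HxH` has an odd number of cosets, and a perfect code would
give an involution in `Hx`. A conjugate `t` of it normalizes `Q` and satisfies `tx⁻¹ ∈ H`; it fixes
the unique involution `z` of `Q`, whose torus `T` contains `x`. Whether or not `tx⁻¹ ∈ T`, a
contradiction follows. -/
theorem not_isPerfectCode_of_mul_self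
    (hD : ∀ z : G, z * z = 1 → z ≠ 1 → ∃ T, IsCyclicTorus z T) {H : Subgroup G} {x : G}
    (hgH : x * x ∈ H) (hg : x * x ≠ 1) {k : ℕ} (hk : (x * x) ^ 2 ^ k = 1)
    (hind : ¬ 2 ∣ (Subgroup.zpowers (x * x)).relIndex H) : ¬ IsPerfectCode (H : Set G) := by
  intro hcode
  have : Fact (Nat.Prime 2) := ⟨Nat.prime_two⟩
  set Q := Subgroup.zpowers (x * x) with hQdef
  have hQH : Q ≤ H := Subgroup.zpowers_le.2 hgH
  have hQ : IsPGroup 2 Q := isPGroup_zpowers hk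
  have hQx : ∀ q ∈ Q, x * q = q * x := by
    intro q hq
    obtain ⟨j, rfl⟩ := Subgroup.mem_zpowers_iff.1 hq
    exact (((Commute.refl x).mul_right (Commute.refl x)).zpow_right j).eq
  have hxQ : MulAut.conj x • Q = Q := conj_smul_eq_of_le fun q hq => by
    rw [hQx q hq]
    simpa using hq
  have h2 : 2 ∣ orderOf (x * x) := two_dvd_orderOf hg hk
  have hx : x ∉ H := by
    intro hxH
    have hxmem : x ∈ Q := mem_of_conj_smul_eq hQH hQ hind hxH hxQ (k := k + 1)
      (by rw [pow_succ', pow_mul, sq, hk])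
    obtain ⟨j, hj⟩ := Subgroup.mem_zpowers_iff.1 hxmem
    have h1 : (x * x) ^ (2 * j - 1) = 1 := by
      have : (x * x) ^ (2 * j) = x * x := by rw [mul_comm, zpow_mul, hj, zpow_two]
      rw [zpow_sub, this, zpow_one, mul_inv_cancel]
    have h3 := (Int.natCast_dvd_natCast.2 h2).trans (orderOf_dvd_iff_zpow_eq_one.2 h1)
    omega
  have hQxH : Q ≤ MulAut.conj x • H := fun q hq => by
    rw [mem_conj_smul, mul_assoc, ← hQx q hq]
    simpa using hQH hq
  obtain ⟨h, hh, ht⟩ := hcode.exists_mul_self_eq_one hx hgH (odd_card_cosets_of_le hQH hind hQxH)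
  have htinv : (h * x)⁻¹ = h * x := inv_eq_of_mul_eq_one_left ht
  have hconj : ∀ y ∈ MulAut.conj x • H, x * y * x⁻¹ ∈ H := by
    intro y hy
    have := H.mul_mem (H.mul_mem hgH (mem_conj_smul.1 hy)) (H.inv_mem hgH)
    convert this using 1
    group
  have htK : MulAut.conj (h * x) • (H ⊓ MulAut.conj x • H) = H ⊓ MulAut.conj x • H := by
    refine conj_smul_eq_of_le fun y hy => ?_
    obtain ⟨hyH, hyx⟩ := Subgroup.mem_inf.1 hy
    refine Subgroup.mem_inf.2 ⟨?_, ?_⟩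
    · have := H.mul_mem (H.mul_mem hh (hconj y hyx)) (H.inv_mem hh)
      convert this using 1
      group
    -- Conjugation by `hx` equals conjugation by its inverse, which brings in `h x² ∈ H`.
    · rw [mem_conj_smul]
      have := H.mul_mem (H.mul_mem (H.inv_mem (H.mul_mem hh hgH)) hyH) (H.mul_mem hh hgH)
      convert this using 1
      calc x⁻¹ * (h * x * y * (h * x)⁻¹) * x = x⁻¹ * ((h * x) * y * (h * x)⁻¹) * x := by group
        _ = x⁻¹ * ((h * x)⁻¹ * y * (h * x)) * x := by rw [htinv]
        _ = _ := by group
  have hQK : ¬ 2 ∣ Q.relIndex (H ⊓ MulAut.conj x • H) := fun hdvd => hind (by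
    rw [← Subgroup.relIndex_mul_relIndex Q (H ⊓ MulAut.conj x • H) H (le_inf hQH hQxH) inf_le_left]
    exact hdvd.mul_right _)
  obtain ⟨y, hy, hyQ⟩ := exists_conj_smul_eq_of_mul_self_eq_one (le_inf hQH hQxH) hQ hQK ht htK
  obtain ⟨t, htdef⟩ : ∃ t, t = y⁻¹ * (h * x) * y := ⟨_, rfl⟩
  rw [← htdef] at hyQ
  have htt : t * t = 1 := by
    calc t * t = y⁻¹ * ((h * x) * (h * x)) * y := by rw [htdef]; group
      _ = 1 := by rw [ht]; group
  have htH : t * x⁻¹ ∈ H := by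
    have := H.mul_mem (H.mul_mem (H.inv_mem (Subgroup.mem_inf.1 hy).1) hh)
      (hconj y (Subgroup.mem_inf.1 hy).2)
    rw [htdef]
    convert this using 1
    group
  obtain ⟨z, hzQ, hz, hz1, -⟩ := exists_central_involution hQ (by
    rw [hQdef, Ne, Subgroup.zpowers_eq_bot]
    exact hg)
  obtain ⟨T, hT⟩ := hD z hz hz1
  have hQcyc : IsCyclic Q := by rw [hQdef]; infer_instance
  have htz : t * z = z * t := by
    have h1 : t * z * t⁻¹ = z := by
      refine eq_of_mul_self_eq_one hQcyc (conj_mem_of_conj_smul_eq hyQ hzQ) hzQ ?_ hz ?_ hz1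
      · calc t * z * t⁻¹ * (t * z * t⁻¹) = t * (z * z) * t⁻¹ := by group
          _ = 1 := by rw [hz]; group
      · intro h
        exact hz1 (by simpa using h)
    rw [← mul_inv_eq_iff_eq_mul]
    exact h1
  have hxT : x ∈ T := by
    by_contra hxT
    exact hg (hT.mul_self x (hQx z hzQ) hxT)
  -- If so, `t ∈ T` has order dividing that of `x²`, so `t ∈ Q` and `x ∈ H`. If not, `tx⁻¹` squares
  -- to 1 and normalizes `Q` inside `H`, so it lies in `Q ≤ T`.
  by_cases htT : t * x⁻¹ ∈ T
  · have htT' : t ∈ T := by simpa using T.mul_mem htT hxT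
    have htQ : t ∈ Q := mem_zpowers_of_mem_isCyclic hT.isCyclic htT' (T.mul_mem hxT hxT)
      ((orderOf_dvd_of_pow_eq_one (by rw [sq, htt])).trans h2)
    have := H.mul_mem (H.inv_mem htH) (hQH htQ)
    exact hx (by simpa using this)
  · have hcomm : t * x⁻¹ * z = z * (t * x⁻¹) := by
      have h1 : Commute x z := hQx z hzQ
      have h2 : Commute t z := htz
      exact (h2.mul_left h1.inv_left).eq
    have h1 := hT.mul_self _ hcomm htT
    have hnorm : MulAut.conj (t * x⁻¹) • Q = Q := by
      rw [map_mul, mul_smul, map_inv, inv_smul_eq_iff.2 hxQ.symm, hyQ]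
    have := mem_of_conj_smul_eq hQH hQ hind htH hnorm (k := 1) (by rw [pow_one, sq, h1])
    exact htT ((Subgroup.zpowers_le.2 (T.mul_mem hxT hxT)) this)

end Involutions

/-! ### Traceless matrices in SL(2, F). -/

section SpecialLinear

variable {F : Type*} [Field F]

lemma det_entries (g : SL(2, F)) : g 0 0 * g 1 1 - g 0 1 * g 1 0 = 1 := by
  rw [← Matrix.det_fin_two, g.det_coe]

lemma mul_entries (g h : SL(2, F)) :
    (g * h) 0 0 = g 0 0 * h 0 0 + g 0 1 * h 1 0 ∧ (g * h) 0 1 = g 0 0 * h 0 1 + g 0 1 * h 1 1 ∧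
    (g * h) 1 0 = g 1 0 * h 0 0 + g 1 1 * h 1 0 ∧ (g * h) 1 1 = g 1 0 * h 0 1 + g 1 1 * h 1 1 := by
  simp [Matrix.SpecialLinearGroup.coe_mul, Matrix.mul_apply, Fin.sum_univ_two]

lemma ext_entries {g h : SL(2, F)} (h00 : g 0 0 = h 0 0) (h01 : g 0 1 = h 0 1)
    (h10 : g 1 0 = h 1 0) (h11 : g 1 1 = h 1 1) : g = h := by
  ext i j
  fin_cases i <;> fin_cases j <;> assumption

lemma mem_center_iff_entries {g : SL(2, F)} :
    g ∈ Subgroup.center SL(2, F) ↔ g 0 1 = 0 ∧ g 1 0 = 0 ∧ g 0 0 = g 1 1 := by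
  rw [Matrix.SpecialLinearGroup.mem_center_iff]
  constructor
  · rintro ⟨r, -, hr⟩
    rw [← hr]
    simp [Matrix.scalar_apply]
  · rintro ⟨h01, h10, h⟩
    have hdet := det_entries g
    refine ⟨g 0 0, ?_, ?_⟩
    · rw [Fintype.card_fin, sq]
      nth_rewrite 2 [h]
      simpa [h01] using hdet
    · ext i j
      fin_cases i <;> fin_cases j <;> simp [Matrix.scalar_apply, h01, h10, h]

/-- An element of `SL(2, F)` whose image in `PSL(2, F)` is an involution has trace zero. -/
lemma trace_eq_zero_of_mul_self_mem_center {g : SL(2, F)}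
    (hgg : g * g ∈ Subgroup.center SL(2, F)) (hg : g ∉ Subgroup.center SL(2, F)) :
    g 1 1 = - g 0 0 := by
  obtain ⟨h1, h2, h3⟩ := mem_center_iff_entries.1 hgg
  obtain ⟨e00, e01, e10, e11⟩ := mul_entries g g
  rw [e01] at h1
  rw [e10] at h2
  rw [e00, e11] at h3
  by_contra hne
  have htr : g 0 0 + g 1 1 ≠ 0 := fun h => hne (by linear_combination h)
  refine hg (mem_center_iff_entries.2 ⟨?_, ?_, ?_⟩)
  · exact (mul_eq_zero.1 (by linear_combination h1 : (g 0 0 + g 1 1) * g 0 1 = 0)).resolve_left htr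
  · exact (mul_eq_zero.1 (by linear_combination h2 : (g 0 0 + g 1 1) * g 1 0 = 0)).resolve_left htr
  · exact sub_eq_zero.1 ((mul_eq_zero.1 (by linear_combination h3 :
      (g 0 0 + g 1 1) * (g 0 0 - g 1 1) = 0)).resolve_left htr)

/-- By Cayley–Hamilton `g² = -1`, so `(1 + g)² = 2g`, and `det (1 + g) = 2`. Hence `(1 + g)/√2` is a
square root of determinant 1. -/
lemma exists_mul_self_eq_of_trace_eq_zero (h2 : (2 : F) ≠ 0) (hsq : IsSquare (2 : F))
    {g : SL(2, F)} (hg : g 1 1 = - g 0 0) : ∃ x : SL(2, F), x * x = g := by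
  obtain ⟨s, hs⟩ := hsq
  have hs0 : s ≠ 0 := by
    rintro rfl
    exact h2 (by simpa using hs)
  have hdet := det_entries g
  rw [hg] at hdet
  have hdet' : (!![(g 0 0 + 1) / s, g 0 1 / s; g 1 0 / s, (1 - g 0 0) / s]).det = 1 := by
    rw [Matrix.det_fin_two_of]
    field_simp
    linear_combination hdet + hs
  refine ⟨⟨_, hdet'⟩, ?_⟩
  obtain ⟨e00, e01, e10, e11⟩ := mul_entries (⟨_, hdet'⟩ : SL(2, F)) ⟨_, hdet'⟩
  refine ext_entries (e00.trans ?_) (e01.trans ?_) (e10.trans ?_) (e11.trans ?_)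
  · change (g 0 0 + 1) / s * ((g 0 0 + 1) / s) + g 0 1 / s * (g 1 0 / s) = g 0 0
    field_simp
    linear_combination (-1) * hdet + g 0 0 * hs
  · change (g 0 0 + 1) / s * (g 0 1 / s) + g 0 1 / s * ((1 - g 0 0) / s) = g 0 1
    field_simp
    linear_combination g 0 1 * hs
  · change g 1 0 / s * ((g 0 0 + 1) / s) + (1 - g 0 0) / s * (g 1 0 / s) = g 1 0
    field_simp
    linear_combination g 1 0 * hs
  · change g 1 0 / s * (g 0 1 / s) + (1 - g 0 0) / s * ((1 - g 0 0) / s) = g 1 1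
    rw [hg]
    field_simp
    linear_combination (-1) * hdet - g 0 0 * hs

lemma entries_of_commute {g h : SL(2, F)} (hc : g * h = h * g) :
    g 0 1 * h 1 0 = g 1 0 * h 0 1 ∧
    g 0 0 * h 0 1 + g 0 1 * h 1 1 = h 0 0 * g 0 1 + h 0 1 * g 1 1 ∧
    g 1 0 * h 0 0 + g 1 1 * h 1 0 = h 1 0 * g 0 0 + h 1 1 * g 1 0 := by
  obtain ⟨a00, a01, a10, a11⟩ := mul_entries g h
  obtain ⟨b00, b01, b10, b11⟩ := mul_entries h g
  rw [hc] at a00 a01 a10 a11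
  exact ⟨by linear_combination b00 - a00, by rw [← a01, b01], by rw [← a10, b10]⟩

/-- The components of a matrix commuting with the traceless `g` with respect to `1` and `g`. -/
lemma eq_add_mul_of_commute (h2 : (2 : F) ≠ 0) {g h : SL(2, F)} (hg : g 1 1 = - g 0 0)
    (hc : g * h = h * g) : ∃ α β : F, h 0 0 = α + β * g 0 0 ∧ h 0 1 = β * g 0 1 ∧
      h 1 0 = β * g 1 0 ∧ h 1 1 = α - β * g 0 0 ∧ α * α + β * β = 1 := by
  obtain ⟨c1, c2, c3⟩ := entries_of_commute hc
  have hdet := det_entries g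
  have hdet' := det_entries h
  rw [hg] at hdet c2 c3
  have key : ∃ α β : F, h 0 0 = α + β * g 0 0 ∧ h 0 1 = β * g 0 1 ∧
      h 1 0 = β * g 1 0 ∧ h 1 1 = α - β * g 0 0 := by
    -- From `h = α + βg`, `tr g = 0` and `g² = -1`: `α = tr h / 2` and `β = -tr (hg) / 2`.
    refine ⟨(h 0 0 + h 1 1) / 2,
      - (h 0 0 * g 0 0 + h 0 1 * g 1 0 + h 1 0 * g 0 1 - h 1 1 * g 0 0) / 2, ?_, ?_, ?_, ?_⟩
    · field_simp
      linear_combination (-h 0 0 + h 1 1) * hdet + g 0 0 * c1 + g 1 0 * c2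
    · field_simp
      linear_combination (-2) * h 0 1 * hdet + g 0 1 * c1 - g 0 0 * c2
    · field_simp
      linear_combination (-2) * h 1 0 * hdet - g 1 0 * c1 + g 0 0 * c3
    · field_simp
      linear_combination (h 0 0 - h 1 1) * hdet - g 0 0 * c1 - g 1 0 * c2
  obtain ⟨α, β, e1, e2, e3, e4⟩ := key
  refine ⟨α, β, e1, e2, e3, e4, ?_⟩
  rw [e1, e2, e3, e4] at hdet'
  linear_combination hdet' - β * β * hdet

/-- The centralizer of a traceless element of `SL(2, F)` is cyclic: it acts on an eigenline of that
element faithfully. -/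
lemma isCyclic_centralizer [Finite F] (h2 : (2 : F) ≠ 0) {g : SL(2, F)} (hg : g 1 1 = - g 0 0) :
    IsCyclic (Subgroup.centralizer {g}) := by
  obtain ⟨i, hi⟩ := IsAlgClosed.exists_pow_nat_eq (-1 : AlgebraicClosure F) (n := 2) (by norm_num)
  let ι := algebraMap F (AlgebraicClosure F)
  have hι : Function.Injective ι := ι.injective
  have hdet := det_entries g
  rw [hg] at hdet
  have hcomm : ∀ h ∈ Subgroup.centralizer {g}, g * h = h * g := fun h hh =>
    Subgroup.mem_centralizer_singleton_iff.1 hh |>.symm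
  -- For `h = α + βg` this is the eigenvalue `α + iβ`, where `i` is an eigenvalue of `g`.
  let χ : SL(2, F) → AlgebraicClosure F := fun h => ι ((h 0 0 + h 1 1) / 2) -
    i * ι ((h 0 0 * g 0 0 + h 0 1 * g 1 0 + h 1 0 * g 0 1 - h 1 1 * g 0 0) / 2)
  have hχ : ∀ (h : SL(2, F)) (α β : F), h 0 0 = α + β * g 0 0 → h 0 1 = β * g 0 1 →
      h 1 0 = β * g 1 0 → h 1 1 = α - β * g 0 0 → χ h = ι α + i * ι β := by
    intro h α β e1 e2 e3 e4
    have f1 : (h 0 0 + h 1 1) / 2 = α := by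
      rw [e1, e4]; field_simp; ring
    have f2 : (h 0 0 * g 0 0 + h 0 1 * g 1 0 + h 1 0 * g 0 1 - h 1 1 * g 0 0) / 2 = -β := by
      rw [e1, e2, e3, e4]
      field_simp
      linear_combination (-2) * β * hdet
    change ι _ - i * ι _ = _
    rw [f1, f2, map_neg]
    ring
  let ψ : Subgroup.centralizer {g} →* AlgebraicClosure F :=
    { toFun := fun h => χ h
      map_one' := by
        change χ 1 = 1
        rw [hχ 1 1 0 (by simp) (by simp) (by simp) (by simp)]
        simp
      map_mul' := by
        rintro ⟨h, hh⟩ ⟨k, hk⟩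
        obtain ⟨α, β, e1, e2, e3, e4, -⟩ := eq_add_mul_of_commute h2 hg (hcomm h hh)
        obtain ⟨γ, δ, f1, f2, f3, f4, -⟩ := eq_add_mul_of_commute h2 hg (hcomm k hk)
        obtain ⟨m1, m2, m3, m4⟩ := mul_entries h k
        change χ (h * k) = χ h * χ k
        rw [hχ h α β e1 e2 e3 e4, hχ k γ δ f1 f2 f3 f4,
          hχ (h * k) (α * γ - β * δ) (α * δ + β * γ)
            (by rw [m1, e1, e2, f1, f3]; linear_combination (-β) * δ * hdet)
            (by rw [m2, e1, e2, f2, f4]; ring)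
            (by rw [m3, e3, e4, f1, f3]; ring)
            (by rw [m4, e3, e4, f2, f4]; linear_combination (-β) * δ * hdet)]
        simp only [map_sub, map_add, map_mul]
        linear_combination (-ι β) * ι δ * hi }
  refine isCyclic_of_injective_ringHom ψ ((injective_iff_map_eq_one' ψ).2 ?_)
  rintro ⟨h, hh⟩
  refine ⟨fun h1 => ?_, fun h1 => by rw [h1, map_one]⟩
  obtain ⟨α, β, e1, e2, e3, e4, e5⟩ := eq_add_mul_of_commute h2 hg (hcomm h hh)
  have h1' : ι α + i * ι β = 1 := by
    rw [← hχ h α β e1 e2 e3 e4]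
    exact h1
  have e5' : ι α * ι α + ι β * ι β = 1 := by
    rw [← map_mul, ← map_mul, ← map_add, e5, map_one]
  have h2' : (2 : AlgebraicClosure F) ≠ 0 := by
    have := (map_ne_zero_iff ι hι).2 h2
    rwa [map_ofNat] at this
  -- `α² + β² = 1` says that `α + iβ` and `α - iβ` are mutually inverse.
  have h3 : ι α - i * ι β = 1 := by
    linear_combination e5' - (ι α - i * ι β) * h1' - ι β * ι β * hi
  have hα : α = 1 := hι (by
    rw [map_one]
    exact mul_left_cancel₀ h2' (by linear_combination h1' + h3))
  have hβ : β = 0 := by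
    rw [hα] at e5
    exact mul_self_eq_zero.1 (by linear_combination e5)
  refine Subtype.ext (ext_entries ?_ ?_ ?_ ?_) <;> simp [e1, e2, e3, e4, hα, hβ]

/-- An element anticommuting with `g` up to a central factor has a central square. -/
lemma mul_self_mem_center_of_commutator {g h : SL(2, F)} (hg : g 1 1 = - g 0 0)
    (h2 : (2 : F) ≠ 0)
    (hc : (g * h)⁻¹ * (h * g) ∈ Subgroup.center SL(2, F)) (hne : g * h ≠ h * g) :
    h * h ∈ Subgroup.center SL(2, F) := by
  obtain ⟨u, hu⟩ : ∃ u, u = (g * h)⁻¹ * (h * g) := ⟨_, rfl⟩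
  rw [← hu] at hc
  have hmul : h * g = (g * h) * u := by rw [hu, mul_inv_cancel_left]
  obtain ⟨u01, u10, u11⟩ := mem_center_iff_entries.1 hc
  have hud := det_entries u
  -- The scalar `u` has determinant 1, so it is `±1`; the value 1 would make `g` and `h` commute.
  have hr : u 0 0 = -1 := by
    rw [u01, ← u11] at hud
    rcases mul_self_eq_one_iff.1 (by linear_combination hud : u 0 0 * u 0 0 = 1) with h1 | h1
    · exact absurd (by
        rw [hmul, (ext_entries (by simpa using h1) (by simpa using u01) (by simpa using u10)
          (by rw [← u11]; simpa using h1) : u = 1), mul_one]) hne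
    · exact h1
  obtain ⟨a00, a01, a10, a11⟩ := mul_entries (g * h) u
  obtain ⟨b00, b01, b10, b11⟩ := mul_entries g h
  obtain ⟨c00, c01, c10, c11⟩ := mul_entries h g
  obtain ⟨d00, d01, d10, d11⟩ := mul_entries h h
  rw [← hmul, c00, b00, b01, u10, hr] at a00
  rw [← hmul, c01, b00, b01, u01, ← u11, hr, hg] at a01
  rw [← hmul, c10, b10, b11, u10, hr, hg] at a10
  rw [← hmul, c11, b10, b11, u01, ← u11, hr, hg] at a11
  have hdet := det_entries g
  rw [hg] at hdet
  have t1 : (h 0 0 + h 1 1) * g 0 1 = 0 := by linear_combination a01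
  have t2 : (h 0 0 + h 1 1) * g 1 0 = 0 := by linear_combination a10
  have t3 : (h 0 0 + h 1 1) * g 0 0 = 0 :=
    (mul_eq_zero.1 (by linear_combination a00 - a11 :
      2 * ((h 0 0 + h 1 1) * g 0 0) = 0)).resolve_left h2
  -- `hg = -gh` gives `tr h · g = 0` entrywise, and `g` is invertible.
  have tr : h 0 0 + h 1 1 = 0 := by
    linear_combination (-(h 0 0 + h 1 1)) * hdet - g 0 0 * t3 - g 1 0 * t1
  rw [mem_center_iff_entries, d00, d01, d10, d11]
  exact ⟨by linear_combination h 0 1 * tr, by linear_combination h 1 0 * tr,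
    by linear_combination (h 0 0 - h 1 1) * tr⟩

end SpecialLinear

/-! ### Involutions of PSL(2, F). -/

section ProjectiveSpecialLinear

variable {F : Type*} [Field F]

/-- The torus is the image of the centralizer of a lift `g` of `z`. An element commuting with `z`
but outside the torus has a lift commuting with `g` only up to a central factor, so its square is
central. -/
lemma exists_isCyclicTorus [Finite F] (h2 : (2 : F) ≠ 0) (z : PSL(2, F)) (hz : z * z = 1)
    (hz1 : z ≠ 1) : ∃ T, IsCyclicTorus z T := by
  induction z using QuotientGroup.induction_on with | H g =>
  have hgg : g * g ∈ Subgroup.center SL(2, F) := (QuotientGroup.eq_one_iff (g * g)).1 hz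
  have hg := trace_eq_zero_of_mul_self_mem_center hgg
    fun h => hz1 ((QuotientGroup.eq_one_iff g).2 h)
  refine ⟨(Subgroup.centralizer {g}).map (QuotientGroup.mk' _), ?_, fun x hx hxT => ?_⟩
  · have := isCyclic_centralizer h2 hg
    exact isCyclic_of_surjective _
      ((QuotientGroup.mk' (Subgroup.center SL(2, F))).subgroupMap_surjective
        (Subgroup.centralizer {g}))
  · induction x using QuotientGroup.induction_on with | H h =>
    refine (QuotientGroup.eq_one_iff (h * h)).2
      (mul_self_mem_center_of_commutator hg h2 (QuotientGroup.eq.1 hx.symm) fun hc => hxT ?_)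
    exact ⟨h, Subgroup.mem_centralizer_singleton_iff.2 hc.symm, rfl⟩

lemma exists_mul_self_eq_of_involution (h2 : (2 : F) ≠ 0) (hsq : IsSquare (2 : F))
    (z : PSL(2, F)) (hz : z * z = 1) (hz1 : z ≠ 1) : ∃ x, x * x = z := by
  induction z using QuotientGroup.induction_on with | H g =>
  have hgg : g * g ∈ Subgroup.center SL(2, F) := (QuotientGroup.eq_one_iff (g * g)).1 hz
  obtain ⟨x, rfl⟩ := exists_mul_self_eq_of_trace_eq_zero h2 hsq
    (trace_eq_zero_of_mul_self_mem_center hgg fun h => hz1 ((QuotientGroup.eq_one_iff g).2 h))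
  exact ⟨(x : PSL(2, F)), rfl⟩

end ProjectiveSpecialLinear

/-- Perfect subgroup codes in a group with cyclic tori in which all involutions are squares. -/
theorem isPerfectCode_iff_of_torus {G : Type*} [Group G] [Finite G]
    (hD : ∀ z : G, z * z = 1 → z ≠ 1 → ∃ T, IsCyclicTorus z T)
    (hS : ∀ z : G, z * z = 1 → z ≠ 1 → ∃ x, x * x = z) (H : Subgroup G) (Q : Sylow 2 H) :
    IsPerfectCode (H : Set G) ↔
      (Q : Subgroup H) = ⊥ ∨ ¬ IsCyclic (Q : Subgroup H) ∨
      (IsCyclic (Q : Subgroup H) ∧ IsMaxCyclicTwoOrder G (Nat.card (Q : Subgroup H))) := by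
  have : Fact (Nat.Prime 2) := ⟨Nat.prime_two⟩
  set P : Subgroup G := (Q : Subgroup H).map H.subtype with hPdef
  have hPH : P ≤ H := Subgroup.map_subtype_le _
  have hP : IsPGroup 2 P := Q.2.map _
  let e : (Q : Subgroup H) ≃* P := (Q : Subgroup H).equivMapOfInjective _ H.subtype_injective
  have hcard : Nat.card (Q : Subgroup H) = Nat.card P := Nat.card_congr e.toEquiv
  have hind : ¬ 2 ∣ P.relIndex H := by
    rw [Subgroup.relIndex, Subgroup.subgroupOf, hPdef,
      Subgroup.comap_map_eq_self_of_injective H.subtype_injective]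
    exact Q.not_dvd_index
  have hbot : (Q : Subgroup H) = ⊥ ↔ P = ⊥ :=
    ((Q : Subgroup H).map_eq_bot_iff_of_injective H.subtype_injective).symm
  rw [hbot, e.isCyclic, hcard]
  constructor
  · intro hcode
    by_contra! hcon
    obtain ⟨hP1, hPc, hmax⟩ := hcon
    obtain ⟨C, hC, hC2, hlt⟩ : ∃ C : Subgroup G, IsCyclic C ∧ IsPGroup 2 C ∧
        Nat.card P < Nat.card C := by
      by_contra! h
      refine hmax hPc ⟨⟨P, hPc, hP, rfl⟩, ?_⟩
      rintro m ⟨C, hC, hC2, rfl⟩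
      exact h C hC hC2
    obtain ⟨g, hg⟩ := (Subgroup.isCyclic_iff_exists_zpowers_eq_top P).1 hPc
    have hg1 : g ≠ 1 := by
      rintro rfl
      exact hP1 (by rw [← hg, Subgroup.zpowers_one_eq_bot])
    obtain ⟨k, hk⟩ : ∃ k, g ^ 2 ^ k = 1 := by
      obtain ⟨k, hk⟩ := hP ⟨g, hg ▸ Subgroup.mem_zpowers g⟩
      exact ⟨k, congrArg Subtype.val hk⟩
    obtain ⟨x, rfl⟩ := exists_mul_self_eq hD hS hg1 hk hC hC2
      (by rwa [← Nat.card_zpowers, hg])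
    exact not_isPerfectCode_of_mul_self hD (hPH (hg ▸ Subgroup.mem_zpowers _)) hg1 hk
      (hg ▸ hind) hcode
  · intro h
    refine isPerfectCode_of_torus hD hPH hP hind (h.imp_right fun h C hC hC2 hle => ?_)
    rcases h with h | ⟨-, -, h⟩
    · exact absurd (Subgroup.isCyclic_of_le hle) h
    · exact (Subgroup.eq_of_le_of_card_ge hle (h ⟨C, hC, hC2, rfl⟩)).symm

end SubgroupCode

theorem theorem4p3 (q : ℕ) (hq : IsPrimePow q)
    (hq8 : (q : ℤ) ≡ 1 [ZMOD 8] ∨ (q : ℤ) ≡ -1 [ZMOD 8])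
    (F : Type*) [Field F] [Finite F] (hF : Nat.card F = q)
    (H : Subgroup PSL(2, F)) (Q : Sylow 2 H) :
    SubgroupCode.IsPerfectCode (H : Set PSL(2, F)) ↔
      (Q : Subgroup H) = ⊥ ∨
      ¬ IsCyclic (Q : Subgroup H) ∨
      (IsCyclic (Q : Subgroup H) ∧
        SubgroupCode.IsMaxCyclicTwoOrder PSL(2, F) (Nat.card (Q : Subgroup H))) := by
  have : Fintype F := Fintype.ofFinite F
  have hmod : Fintype.card F % 8 = 1 ∨ Fintype.card F % 8 = 7 := by
    rw [← Nat.card_eq_fintype_card, hF]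
    simp only [Int.ModEq] at hq8
    omega
  have h2 : (2 : F) ≠ 0 := Ring.two_ne_zero fun h => by
    have := FiniteField.even_card_iff_char_two.1 h
    omega
  -- The second supplementary law: 2 is a nonsquare only for q ≡ ±3 mod 8.
  have hsq : IsSquare (2 : F) := FiniteField.isSquare_two_iff.2 (by omega)
  have : Finite SL(2, F) := inferInstanceAs (Finite {A : Matrix (Fin 2) (Fin 2) F // A.det = 1})
  have : Finite PSL(2, F) :=
    inferInstanceAs (Finite (SL(2, F) ⧸ Subgroup.center SL(2, F)))
  exact SubgroupCode.isPerfectCode_iff_of_torus (SubgroupCode.exists_isCyclicTorus h2)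
    (SubgroupCode.exists_mul_self_eq_of_involution h2 hsq) H Q
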